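/- For Lebesgue measurable sets $A, B \subseteq \mathbb{R}^2$, define their joint upper Banach density by \[ \overline{\delta}(A,B) = \sup_{M \geq 1}\ \limsup_{R \to +\infty}\ \sup_{z \in \mathbb{R}^2}\ \inf_{M \leq r \leq R/2}\ \frac{1}{(2r)^2R^2}\int_{z+[0,R]^2}\int_{\mathbb{R}^2} \mathbf{1}_A(x)\,\mathbf{1}_B(y)\,\mathbf{1}_{[-r,r]^2}(x-y)\, dy\, dx . \] Theorem (two-set Székely problem). Let $A, B \subseteq \mathbb{R}^2$ be Lebesgue measurable sets such that $\overline{\delta}(A,B) > 0$. Then there exists $\lambda_0 = \lambda_0(A,B) > 0$ such that for every real $\lambda \geq \lambda_0$ there exist $x \in A$ and $y \in B$ with $|x-y| = \lambda$, where $|\cdot|$ is the Euclidean norm. -/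

import Mathlib

open MeasureTheory Filter Set
open scoped ENNReal

/-- The Euclidean plane, with the Euclidean norm and Lebesgue measure `volume`. -/
abbrev Plane : Type := EuclideanSpace ℝ (Fin 2)

/-- The axis-parallel square `[a, b]²`. -/
def square (a b : ℝ) : Set Plane := {u | ∀ i, u i ∈ Icc a b}

/-- The translated square `z + [0, R]²`. -/
def cornerSquare (z : Plane) (R : ℝ) : Set Plane := {x | x - z ∈ square 0 R}

/-- The integral over `x ∈ z + [0, R]²` and `y ∈ ℝ²` of `1_A(x) 1_B(y) 1_{[-r, r]²}(x - y)`. -/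
noncomputable def pairIntegral (A B : Set Plane) (z : Plane) (R r : ℝ) : ℝ≥0∞ :=
  ∫⁻ x in cornerSquare z R, ∫⁻ y,
    A.indicator (fun _ => (1 : ℝ≥0∞)) x * B.indicator (fun _ => (1 : ℝ≥0∞)) y *
      (square (-r) r).indicator (fun _ => (1 : ℝ≥0∞)) (x - y)

/-- The joint upper Banach density of `A` and `B`. Suprema, infima and the limit superior are
taken in `[0, ∞]`, so that they always have their literal meaning; the infimum over `r` runs over
an empty set only for `R < 2 * M`, which does not affect the limit superior. -/
noncomputable def jointUpperBanachDensity (A B : Set Plane) : ℝ≥0∞ :=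
  ⨆ (M : ℝ) (_ : 1 ≤ M),
    limsup
      (fun R : ℝ => ⨆ z : Plane, ⨅ (r : ℝ) (_ : r ∈ Icc M (R / 2)),
        pairIntegral A B z R r / ENNReal.ofReal ((2 * r) ^ 2 * R ^ 2))
      atTop

/-! Suppose the forbidden distances are unbounded, and pick forbidden scales `L 0, L 1, ...` growing
geometrically. Let `f`, `g` be the indicators of `A`, `B` cut to a large window of side comparable
to `R`, with translations acting on `L²` of the plane. Averaging `g` along the quarter circle of
radius `L i` gives a function orthogonal to `f`, since no pair is at distance `L i`. Averaging over
the box of half-side `L i` gives a pairing at least `δ R²`, by the density hypothesis. So each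
difference `v i` of the two averages has pairing at most `-δ R²` with `f`.

These differences are almost orthogonal. The law of `u - u'`, for `u`, `u'` independent on the arc,
is absolutely continuous (`differenceLaw_arcMeasure`). By a `T*T` argument and continuity of
translation in `L¹`, an average at scale `lam` is nearly blind to translations much smaller than
`lam`. Pairing it with the arc or the box average at a far smaller scale therefore gives nearly the
same number, and the difference nearly cancels. Hence `‖∑ v i‖²` is at most `n` times a constant
plus a small multiple of `n²`, while Cauchy–Schwarz against `f` forces growth like `n²`: a
contradiction for large `n`. No Fourier decay estimate is used. -/

open scoped Pointwise

/-! ### Translation on `L^p` and its continuity -/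

section Translation

variable {E : Type*} [NormedAddCommGroup E] [InnerProductSpace ℝ E] [FiniteDimensional ℝ E]
  [MeasurableSpace E] [BorelSpace E]

/-- Translation by `v` on real-valued `L^p` functions. -/
noncomputable def translateLp (p : ℝ≥0∞) [Fact (1 ≤ p)] (v : E) :
    Lp ℝ p (volume : Measure E) →ₗᵢ[ℝ] Lp ℝ p (volume : Measure E) :=
  Lp.compMeasurePreservingₗᵢ ℝ (fun x => x - v) (measurePreserving_sub_right volume v)

theorem translateLp_add (p : ℝ≥0∞) [Fact (1 ≤ p)] (v w : E) (h : Lp ℝ p (volume : Measure E)) :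
    translateLp p (v + w) h = translateLp p v (translateLp p w h) := by
  have := Lp.compMeasurePreserving_comp_apply h (measurePreserving_sub_right volume w)
    (measurePreserving_sub_right (volume : Measure E) v)
  have e : (fun x : E => x - (v + w)) = (fun x => x - w) ∘ fun x => x - v := by
    ext x; simp [sub_sub]
  change Lp.compMeasurePreserving (fun x => x - (v + w)) _ h = _
  simp only [e]
  exact this

theorem continuous_translateLp (p : ℝ≥0∞) [Fact (1 ≤ p)] (hp : p ≠ ∞)
    (h : Lp ℝ p (volume : Measure E)) : Continuous fun v => translateLp p v h := by
  let G : C(E, C(E, E)) := ContinuousMap.curry ⟨fun q : E × E => q.2 - q.1, by fun_prop⟩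
  exact Continuous.compMeasurePreservingLp (f := fun _ : E => h) (g := G) continuous_const
    G.continuous (fun v => measurePreserving_sub_right volume v) hp

theorem tendsto_integral_norm_translate_sub {k : E → ℝ} (hk : Integrable k) :
    Tendsto (fun y => ∫ z, ‖k (z - y) - k z‖) (nhds 0) (nhds 0) := by
  have hc := (continuous_translateLp 1 (by simp) hk.toL1).tendsto 0
  have h0 : translateLp 1 (0 : E) hk.toL1 = hk.toL1 := by
    apply (translateLp 1 (0 : E)).injective
    rw [← translateLp_add, add_zero]
  rw [h0] at hc
  have := (hc.sub_const (hk.toL1)).norm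
  rw [sub_self, norm_zero] at this
  refine this.congr fun y => ?_
  rw [L1.norm_eq_integral_norm]
  apply integral_congr_ae
  have h1 : translateLp 1 y hk.toL1 =ᵐ[volume] (hk.toL1 : E → ℝ) ∘ fun x => x - y :=
    Lp.coeFn_compMeasurePreserving _ _
  have h2 := (measurePreserving_sub_right (volume : Measure E) y).quasiMeasurePreserving.ae_eq_comp
    hk.coeFn_toL1
  filter_upwards [h1, h2, hk.coeFn_toL1, Lp.coeFn_sub (translateLp 1 y hk.toL1) hk.toL1]
    with z a b c d
  rw [d, Pi.sub_apply, a, b, c, Function.comp]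

end Translation

/-! ### Orbit averages of isometric representations -/

section Average

variable {E : Type*} [NormedAddCommGroup E]
  {H : Type*} [NormedAddCommGroup H] [InnerProductSpace ℝ H]

/-- A strongly continuous isometric representation of the additive group `E` on `H`. -/
structure IsIsometricRep (U : E → H →ₗᵢ[ℝ] H) : Prop where
  map_add : ∀ x y h, U (x + y) h = U x (U y h)
  continuous : ∀ h, Continuous fun x => U x h

variable {U : E → H →ₗᵢ[ℝ] H}

theorem IsIsometricRep.inner_map_map (hU : IsIsometricRep U) (x y : E) (g h : H) :
    inner ℝ (U x g) (U y h) = inner ℝ (U (x - y) g) h := by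
  rw [← (U y).inner_map_map (U (x - y) g) h, ← hU.map_add, add_sub_cancel]

theorem IsIsometricRep.map_comm (hU : IsIsometricRep U) (x y : E) (h : H) :
    U x (U y h) = U y (U x h) := by
  rw [← hU.map_add, ← hU.map_add, add_comm]

variable [NormedSpace ℝ E] [MeasurableSpace E]

/-- The average of the orbit of `h` along the dilate by `lam` of the measure `μ`. -/
noncomputable def orbitAverage (U : E → H →ₗᵢ[ℝ] H) (μ : Measure E) (lam : ℝ) (h : H) : H :=
  ∫ x, U (lam • x) h ∂μ

/-- The law of `x - y` for independent `x` and `y` with law `μ`. -/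
noncomputable def differenceLaw {E : Type*} [NormedAddCommGroup E] [MeasurableSpace E]
    (μ : Measure E) : Measure E :=
  (μ.prod μ).map fun q => q.1 - q.2

theorem norm_orbitAverage_le (μ : Measure E) [IsProbabilityMeasure μ] (lam : ℝ) (h : H) :
    ‖orbitAverage U μ lam h‖ ≤ ‖h‖ := by
  refine (norm_integral_le_of_norm_le_const (C := ‖h‖) (by simp)).trans ?_
  simp

variable [BorelSpace E] [SecondCountableTopology E]

theorem IsIsometricRep.integrable (hU : IsIsometricRep U) (μ : Measure E) [IsFiniteMeasure μ]
    (lam : ℝ) (h : H) : Integrable (fun x => U (lam • x) h) μ := by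
  refine Integrable.of_bound (C := ‖h‖) ?_ (by simp)
  exact ((hU.continuous h).comp (continuous_const_smul lam)).aestronglyMeasurable

theorem IsIsometricRep.orbitAverage_sub (hU : IsIsometricRep U) (μ : Measure E) [IsFiniteMeasure μ]
    (lam : ℝ) (g h : H) :
    orbitAverage U μ lam (g - h) = orbitAverage U μ lam g - orbitAverage U μ lam h := by
  simp only [orbitAverage, map_sub]
  exact integral_sub (hU.integrable μ lam g) (hU.integrable μ lam h)

instance isProbabilityMeasure_differenceLaw (μ : Measure E) [IsProbabilityMeasure μ] :
    IsProbabilityMeasure (differenceLaw μ) :=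
  Measure.isProbabilityMeasure_map (by fun_prop)

variable [CompleteSpace H]

theorem IsIsometricRep.map_orbitAverage (hU : IsIsometricRep U) (μ : Measure E) [IsFiniteMeasure μ]
    (lam : ℝ) (y : E) (h : H) : U y (orbitAverage U μ lam h) = orbitAverage U μ lam (U y h) := by
  unfold orbitAverage
  have := (U y).toContinuousLinearMap.integral_comp_comm (hU.integrable μ lam h)
  simp only [LinearIsometry.coe_toContinuousLinearMap] at this
  rw [← this]
  simp only [hU.map_comm y]

/-- The `T*T` identity: expanding the square produces the law of a difference, which can be
absolutely continuous even when `μ` is singular. -/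
theorem IsIsometricRep.norm_orbitAverage_sq (hU : IsIsometricRep U) (μ : Measure E)
    [IsProbabilityMeasure μ] (lam : ℝ) (h : H) :
    ‖orbitAverage U μ lam h‖ ^ 2 = inner ℝ (orbitAverage U (differenceLaw μ) lam h) h := by
  have hi : ∀ (ν : Measure E) [IsProbabilityMeasure ν] (w : H),
      inner ℝ (orbitAverage U ν lam h) w = ∫ x, inner ℝ (U (lam • x) h) w ∂ν := by
    intro ν _ w
    rw [real_inner_comm, orbitAverage, ← integral_inner (hU.integrable ν lam h)]
    simp only [real_inner_comm]
  have hc : Continuous fun x => inner ℝ (U (lam • x) h) h :=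
    ((hU.continuous h).comp (continuous_const_smul lam)).inner continuous_const
  rw [← real_inner_self_eq_norm_sq, hi, hi, differenceLaw,
    integral_map (by fun_prop) hc.aestronglyMeasurable, integral_prod]
  · refine integral_congr_ae (.of_forall fun x => ?_)
    change inner ℝ (U (lam • x) h) (∫ _, _ ∂_) = _
    rw [← integral_inner (hU.integrable μ lam h)]
    refine integral_congr_ae (.of_forall fun y => ?_)
    change inner ℝ _ _ = inner ℝ _ _
    rw [hU.inner_map_map, smul_sub]
  · refine Integrable.of_bound (C := ‖h‖ * ‖h‖) ?_ (.of_forall fun q => ?_)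
    · exact (hc.comp (by fun_prop)).aestronglyMeasurable
    · refine (norm_inner_le_norm _ _).trans_eq ?_
      rw [LinearIsometry.norm_map]

end Average

/-! ### Almost orthogonality across scales -/

section Decorrelation

variable {E : Type*} [NormedAddCommGroup E] [InnerProductSpace ℝ E] [FiniteDimensional ℝ E]
  [MeasurableSpace E] [BorelSpace E]
  {H : Type*} [NormedAddCommGroup H] [InnerProductSpace ℝ H]
  {U : E → H →ₗᵢ[ℝ] H}

/-- Translating by `y` inside an average at scale `lam` shifts the density of `ν` by `y / lam`; the
cost is the `L¹` distance between the density and its shift. -/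
theorem IsIsometricRep.norm_orbitAverage_sub_le (hU : IsIsometricRep U) (ν : Measure E)
    [IsFiniteMeasure ν] (hν : ν ≪ volume) {lam : ℝ} (hlam : 0 < lam) (y : E) (h : H) :
    ‖orbitAverage U ν lam (U y h - h)‖ ≤
      (∫ z, ‖(ν.rnDeriv volume (z - lam⁻¹ • y)).toReal - (ν.rnDeriv volume z).toReal‖) * ‖h‖ := by
  set k : E → ℝ := fun z => (ν.rnDeriv volume z).toReal with hkdef
  have hk : Integrable k := Measure.integrable_toReal_rnDeriv
  have hcont : Continuous fun x => U (lam • x) h :=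
    (hU.continuous h).comp (continuous_const_smul lam)
  have hint : ∀ a : E → ℝ, Integrable a → Integrable fun z => a z • U (lam • z) h := by
    intro a ha
    refine (ha.norm.mul_const ‖h‖).mono' (ha.1.smul hcont.aestronglyMeasurable)
      (.of_forall fun z => ?_)
    simp [norm_smul]
  have e1 : orbitAverage U ν lam (U y h) = ∫ z, k (z - lam⁻¹ • y) • U (lam • z) h := by
    rw [orbitAverage, ← integral_rnDeriv_smul hν,
      ← integral_add_right_eq_self (fun z => k (z - lam⁻¹ • y) • U (lam • z) h) (lam⁻¹ • y)]
    refine integral_congr_ae (.of_forall fun z => ?_)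
    simp only [add_sub_cancel_right, hkdef]
    rw [← hU.map_add, smul_add, smul_inv_smul₀ hlam.ne']
  have e2 : orbitAverage U ν lam h = ∫ z, k z • U (lam • z) h := by
    rw [orbitAverage, ← integral_rnDeriv_smul hν]
  have hk' : Integrable fun z => k (z - lam⁻¹ • y) := hk.comp_sub_right _
  rw [hU.orbitAverage_sub, e1, e2, ← integral_sub (hint _ hk') (hint _ hk), ← integral_mul_const]
  refine norm_integral_le_of_norm_le ((hk'.sub hk).norm.mul_const _) (.of_forall fun z => ?_)
  rw [← sub_smul, norm_smul, LinearIsometry.norm_map]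

variable [CompleteSpace H]

/-- The density estimate for the difference law passes to `μ` through the `T*T` identity. The number
`t` does not depend on `g`, so it is uniform over all windows. -/
theorem IsIsometricRep.exists_norm_orbitAverage_sub_le (hU : IsIsometricRep U) (μ : Measure E)
    [IsProbabilityMeasure μ] (hμ : differenceLaw μ ≪ volume) {η : ℝ} (hη : 0 < η) :
    ∃ t > 0, ∀ (lam : ℝ) (y : E) (g : H), 0 < lam → ‖y‖ ≤ t * lam →
      ‖orbitAverage U μ lam (U y g - g)‖ ≤ η * ‖g‖ := by
  have hk : Integrable (fun z => ((differenceLaw μ).rnDeriv volume z).toReal) :=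
    Measure.integrable_toReal_rnDeriv
  have hlim := tendsto_integral_norm_translate_sub hk
  -- Cauchy–Schwarz below multiplies this by `‖U y g - g‖ ≤ 2 * ‖g‖`, leaving exactly `η ^ 2`.
  have hev := hlim.eventually (gt_mem_nhds (show (0 : ℝ) < η ^ 2 / 2 by positivity))
  obtain ⟨t, ht, hball⟩ := Metric.eventually_nhds_iff.1 hev
  refine ⟨t / 2, by positivity, fun lam y g hlam hy => ?_⟩
  have hsmall : dist (lam⁻¹ • y) 0 < t := by
    rw [dist_zero_right, norm_smul, Real.norm_of_nonneg (by positivity), inv_mul_lt_iff₀ hlam]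
    nlinarith [mul_pos ht hlam]
  have h1 := hU.norm_orbitAverage_sub_le _ hμ hlam y g
  have h2 : ‖orbitAverage U (differenceLaw μ) lam (U y g - g)‖ ≤ η ^ 2 / 2 * ‖g‖ :=
    h1.trans (mul_le_mul_of_nonneg_right (hball hsmall).le (norm_nonneg _))
  have h3 : ‖U y g - g‖ ≤ 2 * ‖g‖ := by
    refine (norm_sub_le _ _).trans_eq ?_
    rw [LinearIsometry.norm_map, two_mul]
  refine abs_le_of_sq_le_sq' ?_ (by positivity) |>.2
  calc ‖orbitAverage U μ lam (U y g - g)‖ ^ 2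
      = inner ℝ (orbitAverage U (differenceLaw μ) lam (U y g - g)) (U y g - g) :=
        hU.norm_orbitAverage_sq μ lam _
    _ ≤ _ := real_inner_le_norm _ _
    _ ≤ (η ^ 2 / 2 * ‖g‖) * (2 * ‖g‖) := by gcongr
    _ = (η * ‖g‖) ^ 2 := by ring

/-- The small-scale average only involves translations of length at most `l * ρ`. Each moves across
the inner product to the large-scale average, which barely notices it. -/
theorem IsIsometricRep.abs_inner_orbitAverage_sub_le (hU : IsIsometricRep U)
    (μ ν : Measure E) [IsProbabilityMeasure μ] [IsProbabilityMeasure ν] {ρ t η l lam : ℝ}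
    (hν : ∀ᵐ x ∂ν, ‖x‖ ≤ ρ) (hl : 0 < l) (hρ : l * ρ ≤ t * lam) (g : H)
    (ht : ∀ y : E, ‖y‖ ≤ t * lam → ‖orbitAverage U μ lam (U y g - g)‖ ≤ η * ‖g‖) :
    |inner ℝ (orbitAverage U ν l g) (orbitAverage U μ lam g) - inner ℝ g (orbitAverage U μ lam g)| ≤
      η * ‖g‖ ^ 2 := by
  set a := orbitAverage U μ lam g with ha
  have e1 : inner ℝ (orbitAverage U ν l g) a = ∫ x, inner ℝ a (U (l • x) g) ∂ν := by
    rw [real_inner_comm, orbitAverage, ← integral_inner (hU.integrable ν l g)]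
  have e2 : inner ℝ g a = ∫ _, inner ℝ a g ∂ν := by
    simp [real_inner_comm]
  have hi : Integrable (fun x => inner ℝ a (U (l • x) g)) ν := (hU.integrable ν l g).const_inner a
  rw [e1, e2, ← integral_sub hi (integrable_const _), ← Real.norm_eq_abs]
  refine (norm_integral_le_of_norm_le_const (C := η * ‖g‖ ^ 2) ?_).trans_eq (by simp)
  filter_upwards [hν] with x hx
  have e3 : inner ℝ a (U (l • x) g) = inner ℝ (orbitAverage U μ lam (U (-(l • x)) g)) g := by
    rw [← hU.map_orbitAverage, ← ha]
    have := hU.inner_map_map (-(l • x)) 0 a g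
    -- Not an axiom of the representation: it follows from additivity and injectivity of `U 0`.
    have h0 : U 0 g = g := by
      apply (U 0).injective
      rw [← hU.map_add, add_zero]
    rw [← (U (-(l • x))).inner_map_map, ← hU.map_add, neg_add_cancel, h0]
  rw [e3, ha, ← inner_sub_left, ← hU.orbitAverage_sub]
  refine (norm_inner_le_norm _ _).trans ?_
  have hle : ‖-(l • x)‖ ≤ t * lam := by
    rw [norm_neg, norm_smul, Real.norm_of_nonneg hl.le]
    exact (mul_le_mul_of_nonneg_left hx hl.le).trans hρ
  calc _ ≤ (η * ‖g‖) * ‖g‖ := mul_le_mul_of_nonneg_right (ht _ hle) (norm_nonneg _)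
    _ = _ := by ring

/-- Differences of averages at well separated scales are almost orthogonal. -/
theorem IsIsometricRep.exists_abs_inner_orbitAverage_sub_orbitAverage_le (hU : IsIsometricRep U)
    (μ ν : Measure E) [IsProbabilityMeasure μ] [IsProbabilityMeasure ν]
    (hμ : differenceLaw μ ≪ volume) (hν : differenceLaw ν ≪ volume) {ρ : ℝ}
    (hμρ : ∀ᵐ x ∂μ, ‖x‖ ≤ ρ) (hνρ : ∀ᵐ x ∂ν, ‖x‖ ≤ ρ) {η : ℝ} (hη : 0 < η) :
    ∃ K ≥ 1, ∀ (l lam : ℝ) (g : H), 0 < l → K * l ≤ lam →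
      |inner ℝ (orbitAverage U μ l g - orbitAverage U ν l g)
        (orbitAverage U μ lam g - orbitAverage U ν lam g)| ≤ η * ‖g‖ ^ 2 := by
  obtain ⟨t₁, ht₁, h₁⟩ := hU.exists_norm_orbitAverage_sub_le μ hμ (show 0 < η / 4 by positivity)
  obtain ⟨t₂, ht₂, h₂⟩ := hU.exists_norm_orbitAverage_sub_le ν hν (show 0 < η / 4 by positivity)
  refine ⟨max 1 (max (ρ / t₁) (ρ / t₂)), le_max_left _ _, fun l lam g hl hK => ?_⟩
  have hlam : 0 < lam := by
    refine lt_of_lt_of_le ?_ hK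
    have : (0 : ℝ) < max 1 (max (ρ / t₁) (ρ / t₂)) := lt_max_of_lt_left one_pos
    positivity
  have key : ∀ t > 0, ρ / t ≤ max 1 (max (ρ / t₁) (ρ / t₂)) → l * ρ ≤ t * lam := by
    intro t ht hle
    have : ρ / t * l ≤ lam := (mul_le_mul_of_nonneg_right hle hl.le).trans hK
    rw [div_mul_eq_mul_div, div_le_iff₀ ht] at this
    linarith
  have k₁ := key t₁ ht₁ ((le_max_left _ _).trans (le_max_right _ _))
  have k₂ := key t₂ ht₂ ((le_max_right _ _).trans (le_max_right _ _))
  have a₁ := hU.abs_inner_orbitAverage_sub_le μ μ hμρ hl k₁ g fun y => h₁ lam y g hlam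
  have a₂ := hU.abs_inner_orbitAverage_sub_le μ ν hνρ hl k₁ g fun y => h₁ lam y g hlam
  have a₃ := hU.abs_inner_orbitAverage_sub_le ν μ hμρ hl k₂ g fun y => h₂ lam y g hlam
  have a₄ := hU.abs_inner_orbitAverage_sub_le ν ν hνρ hl k₂ g fun y => h₂ lam y g hlam
  -- For each large-scale average, the two small-scale pairings are both close to its pairing with
  -- `g` itself and cancel, leaving four errors of `η / 4`.
  rw [inner_sub_left, inner_sub_right, inner_sub_right]
  rw [abs_le] at *
  constructor <;> linarith [a₁.1, a₁.2, a₂.1, a₂.2, a₃.1, a₃.2, a₄.1, a₄.2]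

/-- Each new vector adds cross terms of at most `2 * n * b`, absorbed by `(n + 1) ^ 2 - n ^ 2`. -/
theorem norm_sum_range_sq_le {H : Type*} [NormedAddCommGroup H] [InnerProductSpace ℝ H]
    {v : ℕ → H} {a b : ℝ} {n : ℕ} (hb : 0 ≤ b) (hv : ∀ i < n, ‖v i‖ ^ 2 ≤ a)
    (hvv : ∀ i j, i < j → j < n → |inner ℝ (v i) (v j)| ≤ b) :
    ‖∑ i ∈ Finset.range n, v i‖ ^ 2 ≤ n * a + n ^ 2 * b := by
  induction n with
  | zero => simp
  | succ n ih =>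
    have h1 := ih (fun i hi => hv i (by omega)) fun i j hij hj => hvv i j hij (by omega)
    have h2 : inner ℝ (∑ i ∈ Finset.range n, v i) (v n) ≤ n * b := by
      rw [sum_inner]
      refine (Finset.sum_le_card_nsmul _ _ b fun i hi => ?_).trans (by simp)
      exact (le_abs_self _).trans (hvv i n (Finset.mem_range.1 hi) (by omega))
    rw [Finset.sum_range_succ, norm_add_sq_real]
    push_cast
    nlinarith [hv n (by omega)]

end Decorrelation

/-! ### Absolute continuity of differences of points on an arc -/

theorem MeasureTheory.measure_inter_preimage_eq_zero_of_det_fderiv_ne_zero {E : Type*}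
    [NormedAddCommGroup E] [NormedSpace ℝ E] [FiniteDimensional ℝ E] [MeasurableSpace E]
    [BorelSpace E] (μ : Measure E) [μ.IsAddHaarMeasure] {f : E → E} {f' : E → E →L[ℝ] E}
    {s : Set E} (hs : MeasurableSet s) (hf : Measurable f)
    (hf' : ∀ x ∈ s, HasFDerivWithinAt f (f' x) s x) (hinj : InjOn f s)
    (hdet : ∀ x ∈ s, (f' x).det ≠ 0) {N : Set E} (hN : μ N = 0) : μ (s ∩ f ⁻¹' N) = 0 := by
  wlog hNm : MeasurableSet N generalizing N
  · exact measure_mono_null (by gcongr; exact subset_toMeasurable μ N)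
      (this (N := toMeasurable μ N) (by rwa [measure_toMeasurable]) (measurableSet_toMeasurable μ N))
  have hm : MeasurableSet (s ∩ f ⁻¹' N) := hs.inter (hf hNm)
  have h := lintegral_abs_det_fderiv_eq_addHaar_image μ hm
    (fun x hx => (hf' x hx.1).mono inter_subset_left) (hinj.mono inter_subset_left)
  rw [measure_mono_null (image_subset_iff.2 inter_subset_right) hN] at h
  have h0 : ∀ᵐ x ∂μ.restrict (s ∩ f ⁻¹' N), False := by
    have ha := (ae_restrict_iff' hm).1 ((lintegral_eq_zero_iff'
      (aemeasurable_ofReal_abs_det_fderivWithin μ hm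
        fun x hx => (hf' x hx.1).mono inter_subset_left)).1 h)
    rw [ae_restrict_iff' hm]
    filter_upwards [ha] with x hx hxs
    have := hx hxs
    simp only [Pi.zero_apply, ENNReal.ofReal_eq_zero, abs_nonpos_iff] at this
    exact hdet x hxs.1 this
  simpa [ae_iff] using h0

/-- The difference of the points of the unit circle with given angles. -/
noncomputable def circleDifference (q : ℝ × ℝ) : ℝ × ℝ :=
  (Real.cos q.1 - Real.cos q.2, Real.sin q.1 - Real.sin q.2)

/-- The derivative of `circleDifference`. -/
noncomputable def fderivCircleDifference (q : ℝ × ℝ) : ℝ × ℝ →L[ℝ] ℝ × ℝ :=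
  (Matrix.toLin (.finTwoProd ℝ) (.finTwoProd ℝ)
    !![-Real.sin q.1, Real.sin q.2; Real.cos q.1, -Real.cos q.2]).toContinuousLinearMap

theorem hasFDerivAt_circleDifference (q : ℝ × ℝ) :
    HasFDerivAt circleDifference (fderivCircleDifference q) q := by
  unfold fderivCircleDifference circleDifference
  rw [Matrix.toLin_finTwoProd_toContinuousLinearMap]
  convert! HasFDerivAt.prodMk (𝕜 := ℝ)
    (((Real.hasDerivAt_cos q.1).comp_hasFDerivAt q hasFDerivAt_fst).sub
      ((Real.hasDerivAt_cos q.2).comp_hasFDerivAt q hasFDerivAt_snd))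
    (((Real.hasDerivAt_sin q.1).comp_hasFDerivAt q hasFDerivAt_fst).sub
      ((Real.hasDerivAt_sin q.2).comp_hasFDerivAt q hasFDerivAt_snd)) using 2 <;>
  ext <;> simp

theorem det_fderivCircleDifference (q : ℝ × ℝ) :
    (fderivCircleDifference q).det = Real.sin (q.1 - q.2) := by
  unfold fderivCircleDifference
  simp only [LinearMap.det_toContinuousLinearMap, LinearMap.det_toLin, Matrix.det_fin_two_of]
  rw [Real.sin_sub]
  ring

/-- Pairs of distinct angles in the open first quadrant. -/
def distinctAngles : Set (ℝ × ℝ) :=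
  (Ioo 0 (Real.pi / 2) ×ˢ Ioo 0 (Real.pi / 2)) ∩ {q | q.1 ≠ q.2}

/-- A chord of the unit circle is orthogonal to the sum of its endpoints, and the parallelogram law
fixes the length of that sum. A nonzero chord thus determines the sum up to sign, and positive
coordinates fix the sign. -/
theorem eq_of_sub_eq_sub_of_unit {a b c d a' b' c' d' : ℝ} (ha : 0 < a) (hb : 0 < b) (hc : 0 < c)
    (hd : 0 < d) (ha' : 0 < a') (hb' : 0 < b') (hc' : 0 < c') (hd' : 0 < d')
    (h₁ : a ^ 2 + b ^ 2 = 1) (h₂ : c ^ 2 + d ^ 2 = 1) (h₁' : a' ^ 2 + b' ^ 2 = 1)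
    (h₂' : c' ^ 2 + d' ^ 2 = 1) (hne : a ≠ c) (hx : a - c = a' - c') (hy : b - d = b' - d') :
    a = a' ∧ c = c' := by
  set u := a + c with hu
  set v := b + d with hv
  have hu0 : 0 < u := by positivity
  have hv0 : 0 < v := by positivity
  have hu0' : 0 < a' + c' := by positivity
  have hv0' : 0 < b' + d' := by positivity
  have e1 : (a - c) * u + (b - d) * v = 0 := by rw [hu, hv]; linarith
  have e2 : (a - c) * (a' + c') + (b - d) * (b' + d') = 0 := by rw [hx, hy]; linarith
  have e3 : u ^ 2 + v ^ 2 = (a' + c') ^ 2 + (b' + d') ^ 2 := by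
    have h3 : (a - c) ^ 2 + (b - d) ^ 2 = (a' - c') ^ 2 + (b' - d') ^ 2 := by rw [hx, hy]
    rw [hu, hv]; nlinarith
  have hp : (a - c) * (u * (b' + d') - v * (a' + c')) = 0 := by
    linear_combination (b' + d') * e1 - v * e2
  have hpar : u * (b' + d') = v * (a' + c') := by
    rcases mul_eq_zero.1 hp with h | h
    · exact absurd (sub_eq_zero.1 h) hne
    · linarith
  have hsq : u ^ 2 = (a' + c') ^ 2 := by
    have h5 : (u ^ 2 - (a' + c') ^ 2) * ((a' + c') ^ 2 + (b' + d') ^ 2) = 0 := by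
      linear_combination (a' + c') ^ 2 * e3 + (u * (b' + d') + v * (a' + c')) * hpar
    rcases mul_eq_zero.1 h5 with h | h
    · linarith
    · exact absurd h (by positivity)
  have : u = a' + c' := (sq_eq_sq₀ hu0.le hu0'.le).1 hsq
  constructor <;> linarith

/-- The restriction to a quadrant matters: on the full circle `(p, q)` and `(-q, -p)` have the same
difference. -/
theorem injOn_circleDifference : InjOn circleDifference distinctAngles := by
  have hpos : ∀ x ∈ Ioo 0 (Real.pi / 2), 0 < Real.cos x ∧ 0 < Real.sin x := fun x hx =>
    ⟨Real.cos_pos_of_mem_Ioo ⟨by linarith [hx.1, Real.pi_pos], hx.2⟩,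
      Real.sin_pos_of_pos_of_lt_pi hx.1 (by linarith [hx.2, Real.pi_pos])⟩
  have hinj : ∀ x ∈ Ioo 0 (Real.pi / 2), ∀ y ∈ Ioo 0 (Real.pi / 2), Real.cos x = Real.cos y →
      x = y := fun x hx y hy h =>
    Real.injOn_cos ⟨hx.1.le, by linarith [hx.2, Real.pi_pos]⟩
      ⟨hy.1.le, by linarith [hy.2, Real.pi_pos]⟩ h
  rintro ⟨x, y⟩ ⟨⟨hx, hy⟩, hxy⟩ ⟨x', y'⟩ ⟨⟨hx', hy'⟩, -⟩ h
  simp only [circleDifference, Prod.mk.injEq] at h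
  dsimp only at hx hy hx' hy'
  have := eq_of_sub_eq_sub_of_unit (hpos x hx).1 (hpos x hx).2 (hpos y hy).1 (hpos y hy).2
    (hpos x' hx').1 (hpos x' hx').2 (hpos y' hy').1 (hpos y' hy').2 (Real.cos_sq_add_sin_sq x)
    (Real.cos_sq_add_sin_sq y) (Real.cos_sq_add_sin_sq x') (Real.cos_sq_add_sin_sq y')
    (fun hc => hxy (hinj x hx y hy hc)) h.1 h.2
  exact Prod.ext (hinj x hx x' hx' this.1) (hinj y hy y' hy' this.2)

theorem sin_sub_ne_zero_of_mem_distinctAngles {q : ℝ × ℝ} (hq : q ∈ distinctAngles) :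
    Real.sin (q.1 - q.2) ≠ 0 := by
  obtain ⟨⟨h1, h2⟩, h3⟩ := hq
  have := Real.pi_pos
  rw [Ne, Real.sin_eq_zero_iff_of_lt_of_lt (by linarith [h1.1, h2.2]) (by linarith [h1.2, h2.1])]
  exact sub_ne_zero.2 h3

theorem volume_firstQuadrant_inter_preimage_circleDifference {N : Set (ℝ × ℝ)}
    (hN : volume N = 0) :
    volume ((Ioo 0 (Real.pi / 2) ×ˢ Ioo 0 (Real.pi / 2)) ∩ circleDifference ⁻¹' N) = 0 := by
  have hdiag : volume {q : ℝ × ℝ | q.1 = q.2} = 0 := by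
    have hm : MeasurableSet {q : ℝ × ℝ | q.1 = q.2} :=
      measurableSet_eq_fun measurable_fst measurable_snd
    rw [Measure.volume_eq_prod, Measure.measure_prod_null hm]
    refine .of_forall fun x => ?_
    have : Prod.mk x ⁻¹' {q : ℝ × ℝ | q.1 = q.2} = {x} := by ext y; simp [eq_comm]
    change volume (Prod.mk x ⁻¹' {q : ℝ × ℝ | q.1 = q.2}) = 0
    rw [this, Real.volume_singleton]
  have hm : MeasurableSet distinctAngles :=
    (measurableSet_Ioo.prod measurableSet_Ioo).inter
      (measurableSet_eq_fun measurable_fst measurable_snd).compl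
  have hcont : Continuous circleDifference := by unfold circleDifference; fun_prop
  have h := measure_inter_preimage_eq_zero_of_det_fderiv_ne_zero volume hm hcont.measurable
    (fun q _ => (hasFDerivAt_circleDifference q).hasFDerivWithinAt) injOn_circleDifference
    (fun q hq => by
      rw [det_fderivCircleDifference]; exact sin_sub_ne_zero_of_mem_distinctAngles hq) hN
  refine measure_mono_null (fun q hq => ?_) (measure_union_null h hdiag)
  by_cases hqq : q.1 = q.2
  · exact Or.inr hqq
  · exact Or.inl ⟨⟨hq.1, hqq⟩, hq.2⟩

/-! ### Squares and the uniform measure on a box -/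

theorem differenceLaw_absolutelyContinuous {E : Type*} [NormedAddCommGroup E]
    [InnerProductSpace ℝ E] [FiniteDimensional ℝ E] [MeasurableSpace E] [BorelSpace E]
    {μ : Measure E} [SFinite μ] (hμ : μ ≪ volume) : differenceLaw μ ≪ volume := by
  have h := (hμ.prod hμ).map (f := fun q : E × E => q.1 - q.2) (by fun_prop)
  exact h.trans (quasiMeasurePreserving_sub volume volume).absolutelyContinuous

theorem volume_square (a b : ℝ) : volume (square a b) = ENNReal.ofReal (b - a) ^ 2 := by
  have h : square a b = (@WithLp.ofLp 2 (Fin 2 → ℝ)) ⁻¹' Set.pi univ fun _ => Icc a b := by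
    ext u; simp only [square, mem_ofPred_eq, mem_preimage, mem_univ_pi]
  rw [h, (PiLp.volume_preserving_ofLp (Fin 2)).measure_preimage
    (MeasurableSet.univ_pi fun _ => measurableSet_Icc).nullMeasurableSet, volume_pi_pi]
  simp

theorem measurableSet_square (a b : ℝ) : MeasurableSet (square a b) := by
  have h : square a b = ⋂ i, (fun u : Plane => u i) ⁻¹' Icc a b := by ext u; simp [square]
  rw [h]
  exact MeasurableSet.iInter fun i =>
    (by fun_prop : Measurable fun u : Plane => u i) measurableSet_Icc

theorem volume_translate_square (z : Plane) (a b : ℝ) :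
    volume {x | x - z ∈ square a b} = ENNReal.ofReal (b - a) ^ 2 := by
  rw [← volume_square]
  exact (measurePreserving_sub_right volume z).measure_preimage
    (measurableSet_square a b).nullMeasurableSet

theorem smul_square {r : ℝ} (hr : 0 < r) (a b : ℝ) :
    r • square a b = square (r * a) (r * b) := by
  ext u
  rw [mem_smul_set_iff_inv_smul_mem₀ hr.ne']
  simp only [square, mem_ofPred_eq, PiLp.smul_apply, smul_eq_mul, mem_Icc, le_inv_mul_iff₀ hr,
    inv_mul_le_iff₀ hr]

/-- The uniform probability measure on `[-1, 1]²`. -/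
noncomputable def boxMeasure : Measure Plane :=
  ProbabilityTheory.cond volume (square (-1) 1)

instance isProbabilityMeasure_boxMeasure : IsProbabilityMeasure boxMeasure := by
  refine ProbabilityTheory.cond_isProbabilityMeasure_of_finite ?_ ?_ <;>
  rw [volume_square] <;> norm_num

theorem differenceLaw_boxMeasure : differenceLaw boxMeasure ≪ volume :=
  differenceLaw_absolutelyContinuous ProbabilityTheory.cond_absolutelyContinuous

theorem norm_le_two_of_mem_square {u : Plane} (hu : u ∈ square (-1) 1) : ‖u‖ ≤ 2 := by
  rw [EuclideanSpace.norm_eq, Real.sqrt_le_left (by norm_num), Fin.sum_univ_two]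
  simp only [Real.norm_eq_abs, sq_abs]
  have h0 := hu 0
  have h1 := hu 1
  nlinarith [h0.1, h0.2, h1.1, h1.2]

theorem ae_boxMeasure_norm_le : ∀ᵐ u ∂boxMeasure, ‖u‖ ≤ 2 := by
  filter_upwards [ProbabilityTheory.ae_cond_mem (measurableSet_square (-1) 1)] with u hu
  exact norm_le_two_of_mem_square hu

theorem integral_boxMeasure_smul {r : ℝ} (hr : 0 < r) (c : Plane → ℝ) :
    ∫ u, c (r • u) ∂boxMeasure = ((2 * r) ^ 2)⁻¹ * ∫ v in square (-r) r, c v := by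
  have hv : (volume (square (-1) 1))⁻¹.toReal = 4⁻¹ := by
    rw [volume_square]; norm_num [ENNReal.toReal_inv]
  rw [boxMeasure, ProbabilityTheory.cond, integral_smul_measure, hv,
    Measure.setIntegral_comp_smul_of_pos volume c _ hr, smul_square hr]
  simp only [finrank_euclideanSpace, Fintype.card_fin, smul_eq_mul, mul_neg, mul_one]
  rw [mul_pow, mul_inv]
  ring

/-! ### The uniform measure on a quarter circle -/

/-- The point of the unit circle with a given angle. -/
noncomputable def circlePoint (θ : ℝ) : Plane := !₂[Real.cos θ, Real.sin θ]

theorem continuous_circlePoint : Continuous circlePoint := by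
  unfold circlePoint
  refine (PiLp.continuous_toLp 2 _).comp (continuous_pi fun i => ?_)
  fin_cases i
  · exact Real.continuous_cos
  · exact Real.continuous_sin

theorem norm_circlePoint (θ : ℝ) : ‖circlePoint θ‖ = 1 := by
  simp [circlePoint, EuclideanSpace.norm_eq]

/-- The uniform probability measure on the quarter of the unit circle in the first quadrant. -/
noncomputable def arcMeasure : Measure Plane :=
  (ProbabilityTheory.cond volume (Ioo 0 (Real.pi / 2))).map circlePoint

instance isProbabilityMeasure_cond_angles :
    IsProbabilityMeasure (ProbabilityTheory.cond (volume : Measure ℝ) (Ioo 0 (Real.pi / 2))) := by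
  refine ProbabilityTheory.cond_isProbabilityMeasure_of_finite ?_ ?_
  · simp [Real.pi_pos]
  · simp

instance isProbabilityMeasure_arcMeasure : IsProbabilityMeasure arcMeasure :=
  Measure.isProbabilityMeasure_map continuous_circlePoint.aemeasurable

theorem ae_arcMeasure_norm_eq : ∀ᵐ u ∂arcMeasure, ‖u‖ = 1 := by
  rw [arcMeasure, ae_map_iff continuous_circlePoint.aemeasurable
    (measurableSet_eq_fun measurable_norm measurable_const)]
  exact .of_forall norm_circlePoint

/-- This is where the curvature of the circle enters: the Jacobian `sin (θ - θ')` of the difference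
map vanishes in the quadrant only on the diagonal, a null set. -/
theorem differenceLaw_arcMeasure : differenceLaw arcMeasure ≪ volume := by
  refine Measure.AbsolutelyContinuous.mk fun N hN hN0 => ?_
  let T : ℝ × ℝ → Plane := fun p => !₂[p.1, p.2]
  have hT : MeasurePreserving T :=
    (PiLp.volume_preserving_toLp (Fin 2)).comp (volume_preserving_finTwoArrow ℝ).symm
  have hN' : volume (T ⁻¹' N) = 0 := by rwa [hT.measure_preimage hN.nullMeasurableSet]
  have hm := continuous_circlePoint.measurable
  rw [differenceLaw, arcMeasure, Measure.map_prod_map _ _ hm hm,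
    Measure.map_map (by fun_prop) (by fun_prop),
    Measure.map_apply (by fun_prop) hN]
  have hac : (ProbabilityTheory.cond (volume : Measure ℝ) (Ioo 0 (Real.pi / 2))).prod
      (ProbabilityTheory.cond (volume : Measure ℝ) (Ioo 0 (Real.pi / 2))) ≪
      (volume.restrict (Ioo 0 (Real.pi / 2))).prod (volume.restrict (Ioo 0 (Real.pi / 2))) :=
    Measure.AbsolutelyContinuous.prod Measure.smul_absolutelyContinuous
      Measure.smul_absolutelyContinuous
  apply hac
  rw [Measure.prod_restrict, Measure.restrict_apply (hN.preimage (by fun_prop)), inter_comm]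
  convert! volume_firstQuadrant_inter_preimage_circleDifference hN' using 3
  ext q
  have : circlePoint q.1 - circlePoint q.2 = T (circleDifference q) := by
    ext i; fin_cases i <;> simp [circlePoint, T, circleDifference]
  simp [this]

/-! ### Correlations of sets as inner products in `L²` -/

theorem isIsometricRep_translateLp {E : Type*} [NormedAddCommGroup E] [InnerProductSpace ℝ E]
    [FiniteDimensional ℝ E] [MeasurableSpace E] [BorelSpace E] :
    IsIsometricRep (translateLp (E := E) 2) :=
  ⟨translateLp_add 2, continuous_translateLp 2 (by simp)⟩

theorem inner_indicator_translateLp {E : Type*} [NormedAddCommGroup E] [InnerProductSpace ℝ E]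
    [FiniteDimensional ℝ E] [MeasurableSpace E] [BorelSpace E] {s t : Set E}
    (hs : MeasurableSet s) (ht : MeasurableSet t) (hs' : volume s ≠ ∞) (ht' : volume t ≠ ∞)
    (v : E) :
    inner ℝ (indicatorConstLp 2 hs hs' (1 : ℝ)) (translateLp 2 v (indicatorConstLp 2 ht ht' 1)) =
      volume.real (s ∩ (fun x => x - v) ⁻¹' t) := by
  have h : translateLp 2 v (indicatorConstLp 2 ht ht' (1 : ℝ)) = _ :=
    Lp.indicatorConstLp_compMeasurePreserving ht ht' (1 : ℝ) (measurePreserving_sub_right volume v)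
  rw [h]
  exact L2.real_inner_indicatorConstLp_one_indicatorConstLp_one hs _ hs' _

theorem inner_orbitAverage {E : Type*} [NormedAddCommGroup E] [NormedSpace ℝ E]
    [MeasurableSpace E] [BorelSpace E] [SecondCountableTopology E] {H : Type*}
    [NormedAddCommGroup H] [InnerProductSpace ℝ H] [CompleteSpace H] {U : E → H →ₗᵢ[ℝ] H}
    (hU : IsIsometricRep U) (μ : Measure E) [IsFiniteMeasure μ] (lam : ℝ) (f g : H) :
    inner ℝ f (orbitAverage U μ lam g) = ∫ x, inner ℝ f (U (lam • x) g) ∂μ :=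
  (integral_inner (hU.integrable μ lam g) f).symm

theorem measurableSet_cornerSquare (z : Plane) (R : ℝ) : MeasurableSet (cornerSquare z R) :=
  (measurableSet_square 0 R).preimage (measurable_sub_const z)

theorem pairIntegral_congr_ae {A B A' B' : Set Plane} (hA : A' =ᵐ[volume] A)
    (hB : B' =ᵐ[volume] B) (z : Plane) (R r : ℝ) :
    pairIntegral A' B' z R r = pairIntegral A B z R r := by
  have hA1 := indicator_ae_eq_of_ae_eq_set (f := fun _ => (1 : ℝ≥0∞)) hA
  have hB1 := indicator_ae_eq_of_ae_eq_set (f := fun _ => (1 : ℝ≥0∞)) hB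
  refine lintegral_congr_ae (ae_restrict_of_ae ?_)
  filter_upwards [hA1] with x hx
  refine lintegral_congr_ae ?_
  filter_upwards [hB1] with y hy
  rw [hx, hy]

/-- Substitute `v = x - y` and apply Tonelli. Cutting `B` to the enlarged square loses nothing,
because `r ≤ R` keeps `y` within `R` of the window in each coordinate; it makes the indicator of `B`
square integrable. -/
theorem pairIntegral_eq_setLIntegral {A B : Set Plane} (hA : MeasurableSet A)
    (hB : MeasurableSet B) (z : Plane) {R r : ℝ} (hr : r ≤ R) :
    pairIntegral A B z R r = ∫⁻ v in square (-r) r,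
      volume ((A ∩ cornerSquare z R) ∩
        (fun x => x - v) ⁻¹' (B ∩ {y | y - z ∈ square (-R) (2 * R)})) := by
  set A' := A ∩ cornerSquare z R
  set B' := B ∩ {y | y - z ∈ square (-R) (2 * R)}
  have hA' : MeasurableSet A' := hA.inter (measurableSet_cornerSquare z R)
  have hB' : MeasurableSet B' :=
    hB.inter ((measurableSet_square _ _).preimage (measurable_sub_const z))
  have hS := measurableSet_square (-r) r
  have key : ∀ x y, (cornerSquare z R).indicator
      (fun x => A.indicator (fun _ => (1 : ℝ≥0∞)) x * B.indicator (fun _ => (1 : ℝ≥0∞)) y *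
        (square (-r) r).indicator (fun _ => (1 : ℝ≥0∞)) (x - y)) x =
      A'.indicator 1 x * B'.indicator 1 y * (square (-r) r).indicator 1 (x - y) := by
    intro x y
    by_cases hQ : x ∈ cornerSquare z R
    · by_cases hx : x ∈ A
      · by_cases hxy : x - y ∈ square (-r) r
        · have hy : y - z ∈ square (-R) (2 * R) := by
            intro i
            have h1 := hQ i
            have h2 := hxy i
            simp only [PiLp.sub_apply, mem_Icc] at h1 h2 ⊢
            constructor <;> linarith [h1.1, h1.2, h2.1, h2.2]
          by_cases hyB : y ∈ B <;> simp [A', B', hQ, hx, hxy, hy, hyB]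
        · simp [hxy]
      · simp [A', hx]
    · simp [A', hQ]
  have h1 : pairIntegral A B z R r = ∫⁻ x, ∫⁻ y,
      A'.indicator 1 x * B'.indicator 1 y * (square (-r) r).indicator 1 (x - y) := by
    rw [pairIntegral, ← lintegral_indicator (measurableSet_cornerSquare z R)]
    refine lintegral_congr fun x => ?_
    simp only [← key]
    by_cases hQ : x ∈ cornerSquare z R <;> simp [hQ]
  have hmA : Measurable (A'.indicator (1 : Plane → ℝ≥0∞)) := measurable_one.indicator hA'
  have hmB : Measurable (B'.indicator (1 : Plane → ℝ≥0∞)) := measurable_one.indicator hB'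
  have hmS : Measurable ((square (-r) r).indicator (1 : Plane → ℝ≥0∞)) :=
    measurable_one.indicator hS
  have h2 : ∀ x, ∫⁻ y, A'.indicator 1 x * B'.indicator 1 y *
      (square (-r) r).indicator (1 : Plane → ℝ≥0∞) (x - y) =
      ∫⁻ v, A'.indicator 1 x * B'.indicator 1 (x - v) * (square (-r) r).indicator 1 v := by
    intro x
    rw [← lintegral_sub_left_eq_self _ x]
    simp only [sub_sub_cancel]
  rw [h1]
  simp only [h2]
  rw [lintegral_lintegral_swap (by fun_prop), ← lintegral_indicator hS]
  refine lintegral_congr fun v => ?_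
  by_cases hv : v ∈ square (-r) r
  · have hm : MeasurableSet (A' ∩ (fun x => x - v) ⁻¹' B') :=
      hA'.inter (hB'.preimage (measurable_sub_const v))
    simp only [hv, indicator_of_mem, Pi.one_apply, mul_one]
    rw [← lintegral_indicator_one hm]
    refine lintegral_congr fun x => ?_
    rw [inter_indicator_one (s := A')]
    rfl
  · simp [hv]

theorem integral_volume_inter_eq_pairIntegral {A B : Set Plane} (hA : MeasurableSet A)
    (hB : MeasurableSet B) (z : Plane) {R r : ℝ} (hr : r ≤ R) :
    ∫ v in square (-r) r, volume.real ((A ∩ cornerSquare z R) ∩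
        (fun x => x - v) ⁻¹' (B ∩ {y | y - z ∈ square (-R) (2 * R)})) =
      (pairIntegral A B z R r).toReal := by
  rw [pairIntegral_eq_setLIntegral hA hB z hr]
  refine integral_toReal ?_ (.of_forall fun v => ?_)
  · set A' := A ∩ cornerSquare z R
    set B' := B ∩ {y | y - z ∈ square (-R) (2 * R)}
    have hA' : MeasurableSet A' := hA.inter (measurableSet_cornerSquare z R)
    have hB' : MeasurableSet B' :=
      hB.inter ((measurableSet_square _ _).preimage (measurable_sub_const z))
    have hm : MeasurableSet {q : Plane × Plane | q.2 ∈ A' ∧ q.2 - q.1 ∈ B'} :=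
      (hA'.preimage measurable_snd).inter (hB'.preimage (measurable_snd.sub measurable_fst))
    exact (measurable_measure_prodMk_left (ν := volume) hm).aemeasurable
  · refine (measure_mono (inter_subset_left.trans inter_subset_right)).trans_lt
      ((volume_translate_square z 0 R).trans_lt ?_)
    simp

/-! ### Choice of scales and of a dense window -/

theorem exists_lacunary_seq {P : ℝ → Prop} (hP : ∀ l > 0, ∃ lam ≥ l, P lam) {K : ℝ} (hK : 1 ≤ K)
    {M : ℝ} (hM : 0 < M) :
    ∃ L : ℕ → ℝ, (∀ n, M ≤ L n ∧ P (L n)) ∧ Monotone L ∧ ∀ i j, i < j → K * L i ≤ L j := by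
  have hP' : ∀ l, ∃ lam, l ≤ lam ∧ M ≤ lam ∧ P lam := fun l => by
    obtain ⟨lam, h, hp⟩ := hP (max l M) (lt_max_of_lt_right hM)
    exact ⟨lam, (le_max_left _ _).trans h, (le_max_right _ _).trans h, hp⟩
  choose F hF using hP'
  let L : ℕ → ℝ := fun n => Nat.rec (F M) (fun _ l => F (K * l)) n
  have hsucc : ∀ n, K * L n ≤ L (n + 1) := fun n => (hF _).1
  have hL : ∀ n, M ≤ L n ∧ P (L n) := by
    intro n
    cases n with
    | zero => exact (hF _).2
    | succ n => exact (hF _).2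
  have hmono : Monotone L := monotone_nat_of_le_succ fun n =>
    (le_mul_of_one_le_left (hM.le.trans (hL n).1) hK).trans (hsucc n)
  exact ⟨L, hL, hmono, fun i j hij => (hsucc i).trans (hmono hij)⟩

/-- `M` and `δ` come before `R₀`, so finitely many scales can be fixed from them before a window
that is dense at all those scales is chosen. -/
theorem exists_of_jointUpperBanachDensity_pos {A B : Set Plane}
    (h : 0 < jointUpperBanachDensity A B) :
    ∃ M δ : ℝ, 1 ≤ M ∧ 0 < δ ∧ ∀ R₀ : ℝ, ∃ R ≥ R₀, ∃ z : Plane, ∀ r ∈ Icc M (R / 2),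
      ENNReal.ofReal (δ * ((2 * r) ^ 2 * R ^ 2)) ≤ pairIntegral A B z R r := by
  simp only [jointUpperBanachDensity, lt_iSup_iff] at h
  obtain ⟨M, hM, h⟩ := h
  obtain ⟨δ, hδ, h⟩ := ENNReal.lt_iff_exists_nnreal_btwn.1 h
  refine ⟨M, δ, hM, by exact_mod_cast hδ, fun R₀ => ?_⟩
  obtain ⟨R, hR, hR₀⟩ := ((frequently_lt_of_lt_limsup (by isBoundedDefault) h).and_eventually
    (eventually_ge_atTop (max R₀ 1))).exists
  obtain ⟨z, hz⟩ := lt_iSup_iff.1 hR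
  refine ⟨R, (le_max_left _ _).trans hR₀, z, fun r hr => ?_⟩
  have hR1 : 0 < R := one_pos.trans_le ((le_max_right _ _).trans hR₀)
  have hr1 : 0 < r := one_pos.trans_le (hM.trans hr.1)
  have hpos : 0 < (2 * r) ^ 2 * R ^ 2 := by positivity
  have := (hz.le.trans (iInf₂_le r hr))
  rw [ENNReal.le_div_iff_mul_le (.inl (by simpa using hpos)) (.inl ENNReal.ofReal_ne_top)] at this
  rwa [ENNReal.ofReal_mul δ.coe_nonneg, ENNReal.ofReal_coe_nnreal]

/-! ### The contradiction -/

theorem theorem1 (A B : Set Plane)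
    (hA : NullMeasurableSet A volume) (hB : NullMeasurableSet B volume)
    (hAB : 0 < jointUpperBanachDensity A B) :
    ∃ lam₀ : ℝ, 0 < lam₀ ∧ ∀ lam : ℝ, lam₀ ≤ lam → ∃ x ∈ A, ∃ y ∈ B, ‖x - y‖ = lam := by
  by_contra! hbad
  obtain ⟨M, δ, hM, hδ, hdens⟩ := exists_of_jointUpperBanachDensity_pos hAB
  obtain ⟨A₀, hA₀A, hA₀, hA₀e⟩ := hA.exists_measurable_subset_ae_eq
  obtain ⟨B₀, hB₀B, hB₀, hB₀e⟩ := hB.exists_measurable_subset_ae_eq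
  have hU := isIsometricRep_translateLp (E := Plane)
  obtain ⟨K, hK, horth⟩ := hU.exists_abs_inner_orbitAverage_sub_orbitAverage_le
    arcMeasure boxMeasure
    differenceLaw_arcMeasure differenceLaw_boxMeasure
    (ae_arcMeasure_norm_eq.mono fun x hx => hx.trans_le one_le_two) ae_boxMeasure_norm_le
    -- Since `‖g‖ ^ 2 ≤ 9 * R ^ 2`, this makes the off-diagonal part at most half of the lower bound
    -- `n ^ 2 * δ ^ 2 * R ^ 4`. The diagonal part is at most `36 * n * R ^ 4`, whence the threshold
    -- `72 / δ ^ 2` for `n`.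
    (show 0 < δ ^ 2 / 18 by positivity)
  obtain ⟨L, hL, hLmono, hLK⟩ := exists_lacunary_seq hbad hK (one_pos.trans_le hM)
  obtain ⟨n, hn⟩ := exists_nat_gt (72 / δ ^ 2)
  -- By monotonicity every `L i` with `i < n` then lies in the admissible range `[M, R / 2]`.
  obtain ⟨R, hR, z, hz⟩ := hdens (2 * L n)
  have hLpos : ∀ i, 0 < L i := fun i => one_pos.trans_le (hM.trans (hL i).1)
  have hRpos : 0 < R := lt_of_lt_of_le (by linarith [hLpos n]) hR
  set A' := A₀ ∩ cornerSquare z R with hA'def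
  set B' := B₀ ∩ {y | y - z ∈ square (-R) (2 * R)} with hB'def
  have hA' : MeasurableSet A' := hA₀.inter (measurableSet_cornerSquare z R)
  have hB' : MeasurableSet B' :=
    hB₀.inter ((measurableSet_square _ _).preimage (measurable_sub_const z))
  have hvA : volume A' ≤ ENNReal.ofReal (R ^ 2) := by
    refine (measure_mono inter_subset_right).trans_eq ((volume_translate_square z 0 R).trans ?_)
    rw [ENNReal.ofReal_pow hRpos.le, sub_zero]
  have hvB : volume B' ≤ ENNReal.ofReal ((3 * R) ^ 2) := by
    refine (measure_mono inter_subset_right).trans_eq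
      ((volume_translate_square z (-R) (2 * R)).trans ?_)
    rw [ENNReal.ofReal_pow (by positivity)]
    congr 2
    ring
  have hA'fin : volume A' ≠ ∞ := (hvA.trans_lt ENNReal.ofReal_lt_top).ne
  have hB'fin : volume B' ≠ ∞ := (hvB.trans_lt ENNReal.ofReal_lt_top).ne
  set f := indicatorConstLp 2 hA' hA'fin (1 : ℝ)
  set g := indicatorConstLp 2 hB' hB'fin (1 : ℝ)
  have hf : ‖f‖ ^ 2 ≤ R ^ 2 := by
    rw [← real_inner_self_eq_norm_sq, L2.real_inner_indicatorConstLp_one_indicatorConstLp_one,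
      inter_self]
    exact ENNReal.toReal_le_of_le_ofReal (by positivity) hvA
  have hg : ‖g‖ ^ 2 ≤ (3 * R) ^ 2 := by
    rw [← real_inner_self_eq_norm_sq, L2.real_inner_indicatorConstLp_one_indicatorConstLp_one,
      inter_self]
    exact ENNReal.toReal_le_of_le_ofReal (by positivity) hvB
  have harc : ∀ i, inner ℝ f (orbitAverage (translateLp 2) arcMeasure (L i) g) = 0 := by
    intro i
    rw [inner_orbitAverage hU]
    refine integral_eq_zero_of_ae ?_
    filter_upwards [ae_arcMeasure_norm_eq] with u hu
    rw [inner_indicator_translateLp]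
    -- A point `x` here would give `x ∈ A` and `x - L i • u ∈ B` at the forbidden distance `L i`.
    have : A' ∩ (fun x => x - L i • u) ⁻¹' B' = ∅ := by
      refine eq_empty_of_forall_notMem fun x hx => ?_
      refine (hL i).2 x (hA₀A hx.1.1) _ (hB₀B hx.2.1) ?_
      rw [sub_sub_cancel, norm_smul, hu, mul_one, Real.norm_of_nonneg (hLpos i).le]
    rw [this]
    simp
  have hbox : ∀ i < n, δ * R ^ 2 ≤
      inner ℝ f (orbitAverage (translateLp 2) boxMeasure (L i) g) := by
    intro i hi
    have hiR : L i ≤ R / 2 := by linarith [hLmono hi.le]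
    have hpair := hz (L i) ⟨(hL i).1, hiR⟩
    rw [← pairIntegral_congr_ae hA₀e hB₀e] at hpair
    have hpairtop : pairIntegral A₀ B₀ z R (L i) ≠ ∞ := by
      rw [pairIntegral_eq_setLIntegral hA₀ hB₀ z (by linarith)]
      refine ((lintegral_mono fun v => (measure_mono inter_subset_left).trans hvA).trans_lt ?_).ne
      rw [lintegral_const, Measure.restrict_apply_univ, volume_square]
      exact ENNReal.mul_lt_top ENNReal.ofReal_lt_top (ENNReal.pow_lt_top ENNReal.ofReal_lt_top)
    rw [inner_orbitAverage hU]
    simp only [f, g, inner_indicator_translateLp]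
    rw [integral_boxMeasure_smul (hLpos i)
        (fun v => volume.real (A' ∩ (fun x => x - v) ⁻¹' B')),
      integral_volume_inter_eq_pairIntegral hA₀ hB₀ z (by linarith),
      le_inv_mul_iff₀ (by have := hLpos i; positivity)]
    calc (2 * L i) ^ 2 * (δ * R ^ 2) = δ * ((2 * L i) ^ 2 * R ^ 2) := by ring
      _ ≤ _ := (ENNReal.ofReal_le_iff_le_toReal hpairtop).1 hpair
  set v : ℕ → Lp ℝ 2 (volume : Measure Plane) := fun i =>
    orbitAverage (translateLp 2) arcMeasure (L i) g -
      orbitAverage (translateLp 2) boxMeasure (L i) g with hv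
  have hnorm : ∀ i < n, ‖v i‖ ^ 2 ≤ 4 * ‖g‖ ^ 2 := by
    intro i _
    have h1 : ‖v i‖ ≤ 2 * ‖g‖ := by
      refine (norm_sub_le _ _).trans ?_
      rw [two_mul]
      exact add_le_add (norm_orbitAverage_le _ _ _) (norm_orbitAverage_le _ _ _)
    calc ‖v i‖ ^ 2 ≤ (2 * ‖g‖) ^ 2 := by gcongr
      _ = _ := by ring
  have hsum := norm_sum_range_sq_le (v := v) (n := n) (b := δ ^ 2 / 18 * ‖g‖ ^ 2) (by positivity)
    hnorm fun i j hij _ => horth (L i) (L j) g (hLpos i) (hLK i j hij)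
  set V := ∑ i ∈ Finset.range n, v i
  have hlow : n * (δ * R ^ 2) ≤ -inner ℝ f V := by
    rw [inner_sum, ← Finset.sum_neg_distrib]
    refine le_trans (by simp) (Finset.card_nsmul_le_sum (Finset.range n) _ (δ * R ^ 2) ?_)
    intro i hi
    rw [hv, inner_sub_right, harc, zero_sub, neg_neg]
    exact hbox i (Finset.mem_range.1 hi)
  have hCS : n * (δ * R ^ 2) ≤ ‖f‖ * ‖V‖ :=
    hlow.trans ((neg_le_abs _).trans (abs_real_inner_le_norm _ _))
  have hn0 : (0 : ℝ) < n := lt_trans (by positivity) hn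
  have hsq : (n * (δ * R ^ 2)) ^ 2 ≤ R ^ 2 * ((4 * n + n ^ 2 * (δ ^ 2 / 18)) * (3 * R) ^ 2) :=
    calc (n * (δ * R ^ 2)) ^ 2 ≤ (‖f‖ * ‖V‖) ^ 2 := by gcongr
      _ = ‖f‖ ^ 2 * ‖V‖ ^ 2 := by ring
      _ ≤ R ^ 2 * (n * (4 * ‖g‖ ^ 2) + n ^ 2 * (δ ^ 2 / 18 * ‖g‖ ^ 2)) := by gcongr
      _ = R ^ 2 * ((4 * n + n ^ 2 * (δ ^ 2 / 18)) * ‖g‖ ^ 2) := by ring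
      _ ≤ _ := by gcongr
  rw [div_lt_iff₀ (by positivity)] at hn
  have hcancel : (n : ℝ) * R ^ 4 * (n * δ ^ 2) ≤ n * R ^ 4 * 72 := by nlinarith
  exact absurd (le_of_mul_le_mul_left hcancel (by positivity)) (not_le.2 hn)
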